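/- Let $d\ge 0$. A lattice polytope in $\mathbb R^d$ is the convex hull of finitely many points of $\mathbb Z^d$, and for an integer $t\ge 1$ we write $tP=\{tx : x\in P\}$. For a lattice polytope $P\subset\mathbb R^d$, let $L(P)$ be the largest number of lattice polytopes of positive dimension whose Minkowski sum is contained in $P$, and, for $1\le n\le d$, let $L_n(P)$ be the largest number of lattice polytopes of positive dimension whose Minkowski sum is at most $n$-dimensional and is contained in $P$ (these numbers are $0$ if there are no such polytopes). Put $$\lambda(P)=\sup_{t\ge 1}\frac{L(tP)}{t},\qquad \lambda_n(P)=\sup_{t\ge 1}\frac{L_n(tP)}{t},$$ where $t$ runs over the positive integers. Theorem. Let $P\subset\mathbb R^d$ be a lattice polytope. Then the numbers $L(tP)$, $L_n(tP)$ for $t \ge 1$ and the suprema $\lambda(P)$, $\lambda_n(P)$ are finite, and there is an integer $k\ge 1$ with $$\lambda(P)=\frac{L(kP)}{k}.$$ Likewise, for every $1\le n\le d$ there is an integer $k_n\ge 1$ with $$\lambda_n(P)=\frac{L_n(k_nP)}{k_n}.$$ In particular, $\lambda(P)$ and all $\lambda_n(P)$ are rational numbers. -/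

import Mathlib

open scoped Pointwise

namespace MinkowskiLength

/-- A lattice polytope in `ℝ^d`: the convex hull of finitely many points of `ℤ^d`. -/
def IsLatticePolytope {d : ℕ} (P : Set (Fin d → ℝ)) : Prop :=
  ∃ S : Finset (Fin d → ℤ),
    P = convexHull ℝ ((fun (z : Fin d → ℤ) (i : Fin d) => (z i : ℝ)) '' (S : Set (Fin d → ℤ)))

/-- The dimension of a subset of `ℝ^d`: the dimension of (the direction of) its affine span. -/
noncomputable def dimension {d : ℕ} (P : Set (Fin d → ℝ)) : ℕ :=
  Module.finrank ℝ (vectorSpan ℝ P)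

/-- The numbers `m` for which there are `m` lattice polytopes of positive dimension whose
Minkowski sum is contained in `P`. -/
def decompositionCounts {d : ℕ} (P : Set (Fin d → ℝ)) : Set ℕ :=
  {m | ∃ Q : Fin m → Set (Fin d → ℝ),
    (∀ i, IsLatticePolytope (Q i) ∧ 0 < dimension (Q i)) ∧ ∑ i, Q i ⊆ P}

/-- The numbers `m` for which there are `m` lattice polytopes of positive dimension whose
Minkowski sum is at most `n`-dimensional and is contained in `P`. -/
def decompositionCountsOfDim {d : ℕ} (n : ℕ) (P : Set (Fin d → ℝ)) : Set ℕ :=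
  {m | ∃ Q : Fin m → Set (Fin d → ℝ),
    (∀ i, IsLatticePolytope (Q i) ∧ 0 < dimension (Q i)) ∧
      dimension (∑ i, Q i) ≤ n ∧ ∑ i, Q i ⊆ P}

/-- The Minkowski length `L(P)`: the largest number of lattice polytopes of positive dimension
whose Minkowski sum is contained in `P` (it is `0` if there are none). -/
noncomputable def minkowskiLength {d : ℕ} (P : Set (Fin d → ℝ)) : ℕ :=
  sSup (decompositionCounts P)

/-- The `n`-th Minkowski length `L_n(P)`: the largest number of lattice polytopes of positive
dimension whose Minkowski sum is at most `n`-dimensional and is contained in `P` (it is `0` if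
there are none). -/
noncomputable def nthMinkowskiLength {d : ℕ} (n : ℕ) (P : Set (Fin d → ℝ)) : ℕ :=
  sSup (decompositionCountsOfDim n P)

/-- The rational Minkowski length `λ(P) = sup_{t ≥ 1} L(tP) / t`. -/
noncomputable def rationalMinkowskiLength {d : ℕ} (P : Set (Fin d → ℝ)) : ℝ :=
  ⨆ t : ℕ+, (minkowskiLength ((t : ℝ) • P) : ℝ) / (t : ℝ)

/-- The `n`-th rational Minkowski length `λ_n(P) = sup_{t ≥ 1} L_n(tP) / t`. -/
noncomputable def nthRationalMinkowskiLength {d : ℕ} (n : ℕ) (P : Set (Fin d → ℝ)) : ℝ :=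
  ⨆ t : ℕ+, (nthMinkowskiLength n ((t : ℝ) • P) : ℝ) / (t : ℝ)

end MinkowskiLength

/-! Only segments matter: two distinct lattice points in each summand turn a decomposition inside
`tP` into a lattice zonotope with nonzero edge vectors, and conversely. So the claim is that (number
of edges)/`t` has a maximum over zonotopes of rank at most `n` in dilates of `P`.

Three facts carry the proof. Halving: two edges `v ≠ ±w` congruent mod 2 can be replaced by two
copies of `(v + w) / 2`, so at most `2 * 2 ^ d` distinct edge vectors are needed
(`Fits.exists_few_directions`). Gordan: for a fixed finite set of directions the zonotopes are
governed by a linear Diophantine system, and the ratio is maximal at one of its finitely many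
minimal solutions (`exists_max_of_finite_directions`). Length: the total edge length in `tP` is
`O(t)`, so long edges contribute little to the ratio (`exists_length_bound`).

If no maximum existed, better and better zonotopes with few directions would have to share ever
larger sets of directions: those supported on a shared set `D` have bounded, attained ratio, long
extra edges cannot make up the gap, and so some short extra direction recurs. This ends up exceeding
`2 * 2 ^ d` directions (`exists_max_config`). -/

namespace MinkowskiLength

/-! ### Minimal solutions and maximal ratios -/

/-- Gordan's lemma in the form used below: on a set of vectors of natural numbers that is closed
under the subtraction of smaller members, the ratio of two additive functions attains its
maximum. -/
theorem exists_max_ratio {κ : Type*} [Finite κ] (X : Set (κ → ℕ))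
    (hX : ∀ x ∈ X, ∀ y ∈ X, x ≤ y → y - x ∈ X) (f g : (κ → ℕ) →+ ℕ)
    (hfg : ∀ x ∈ X, g x = 0 → f x = 0) (hne : ∃ x ∈ X, 0 < g x) :
    ∃ x ∈ X, 0 < g x ∧ ∀ y ∈ X, f y * g x ≤ f x * g y := by
  -- The minimal nonzero members form an antichain in `κ → ℕ`, hence a finite set by Dickson's
  -- lemma. Closure under subtraction makes every member of `X` a sum of them.
  set M : Set (κ → ℕ) := {x | Minimal (fun x => x ∈ X ∧ x ≠ 0) x} with hM
  have hMm : ∀ {x}, x ∈ M → Minimal (fun x => x ∈ X ∧ x ≠ 0) x := fun hx => by simpa [M] using hx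
  have hMfin : M.Finite :=
    (setOfPred_minimal_antichain (fun x : κ → ℕ => x ∈ X ∧ x ≠ 0)).finite_of_wellQuasiOrdered
      wellQuasiOrdered_le
  have hle : ∀ y ∈ X, y ≠ 0 → ∃ x ∈ M, x ≤ y := by
    intro y hy h0
    obtain ⟨x, hx, hx'⟩ := exists_minimal_le_of_wellFoundedLT
      (fun x : κ → ℕ => x ∈ X ∧ x ≠ 0) y ⟨hy, h0⟩
    exact ⟨x, by simpa [M] using hx', hx⟩
  have hsub : ∀ x ∈ M, ∀ y, x ≤ y → y - x < y := by
    intro x hx y hxy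
    refine lt_of_le_of_ne tsub_le_self fun h => (hMm hx).prop.2 ?_
    have := tsub_add_cancel_of_le hxy
    rw [h] at this
    simpa using this
  have hMne : ∀ y ∈ X, 0 < g y → ∃ x ∈ M, 0 < g x := by
    intro y
    induction y using WellFoundedLT.induction with
    | ind y ih =>
      intro hy hgy
      have h0 : y ≠ 0 := by rintro rfl; simp at hgy
      obtain ⟨x, hx, hxy⟩ := hle y hy h0
      by_cases hgx : 0 < g x
      · exact ⟨x, hx, hgx⟩
      · refine ih _ (hsub x hx y hxy) (hX x (hMm hx).prop.1 y hy hxy) ?_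
        have := map_add g (y - x) x
        rw [tsub_add_cancel_of_le hxy] at this
        omega
  obtain ⟨y₀, hy₀, hgy₀⟩ := hne
  obtain ⟨x₁, hx₁, hgx₁⟩ := hMne y₀ hy₀ hgy₀
  obtain ⟨x, ⟨hxM, hgx⟩, hmax⟩ := Set.exists_max_image (M ∩ {x | 0 < g x})
    (fun x => (f x : ℚ) / g x) (hMfin.subset Set.inter_subset_left) ⟨x₁, hx₁, hgx₁⟩
  refine ⟨x, (hMm hxM).prop.1, hgx, fun y => ?_⟩
  induction y using WellFoundedLT.induction with
  | ind y ih =>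
    intro hy
    by_cases h0 : y = 0
    · simp [h0]
    obtain ⟨z, hz, hzy⟩ := hle y hy h0
    have h1 := ih _ (hsub z hz y hzy) (hX z (hMm hz).prop.1 y hy hzy)
    -- The maximum was taken over generators with `g z > 0`; the others have `f z = 0`. Adding up
    -- the inequalities over generators is the mediant inequality.
    have h2 : f z * g x ≤ f x * g z := by
      rcases Nat.eq_zero_or_pos (g z) with hgz | hgz
      · simp [hfg z (hMm hz).prop.1 hgz]
      · have := hmax z ⟨hz, hgz⟩
        rw [div_le_div_iff₀ (by exact_mod_cast hgz) (by exact_mod_cast hgx)] at this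
        exact_mod_cast this
    have hf := map_add f (y - z) z
    have hg := map_add g (y - z) z
    rw [tsub_add_cancel_of_le hzy] at hf hg
    rw [hf, hg]
    nlinarith

/-! ### Rational weights for lattice points of dilates -/

/-- The inclusion of `ℤ^d` into `ℝ^d`. -/
def latticeEmb (d : ℕ) : (Fin d → ℤ) →+ (Fin d → ℝ) := (Int.castAddHom ℝ).compLeft (Fin d)

@[simp]
theorem latticeEmb_apply {d : ℕ} (z : Fin d → ℤ) (i : Fin d) : latticeEmb d z i = (z i : ℝ) := rfl

theorem latticeEmb_injective (d : ℕ) : Function.Injective (latticeEmb d) := fun x y h => by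
  ext i
  have := congrFun h i
  simpa using this

theorem exists_common_denominator {ι : Type*} [Fintype ι] (q : ι → ℚ) (hq : ∀ i, 0 ≤ q i) :
    ∃ k : ℕ, 0 < k ∧ ∃ c : ι → ℕ, ∀ i, (c i : ℚ) = k * q i := by
  classical
  refine ⟨∏ i, (q i).den, Finset.prod_pos fun i _ => (q i).den_pos,
    fun i => (∏ j ∈ Finset.univ.erase i, (q j).den) * (q i).num.toNat, fun i => ?_⟩
  have h1 : (((q i).num.toNat : ℕ) : ℚ) = ((q i).num : ℚ) := by
    have := Int.toNat_of_nonneg (Rat.num_nonneg.2 (hq i))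
    exact_mod_cast this
  rw [← Finset.mul_prod_erase Finset.univ _ (Finset.mem_univ i)]
  push_cast
  rw [h1]
  rw [← Rat.mul_den_eq_num (q i)]
  ring

/-- A lattice point of a dilated lattice polytope is, up to a multiple, a combination of the
vertices with natural coefficients. -/
theorem exists_nat_weights {d : ℕ} (V : Finset (Fin d → ℤ)) (x : Fin d → ℤ) {t : ℕ} (ht : 0 < t)
    (hx : latticeEmb d x ∈ (t : ℝ) • convexHull ℝ (latticeEmb d '' (V : Set (Fin d → ℤ)))) :
    ∃ k : ℕ, 0 < k ∧ ∃ c : V → ℕ, ∑ p, c p • (p : Fin d → ℤ) = k • x ∧ ∑ p, c p = k * t := by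
  classical
  obtain ⟨y, hy, hyx⟩ := hx
  -- Carathéodory gives affinely independent vertices, so the weights are unique; this forces them
  -- to be rational.
  obtain ⟨ι, _, z, w, hz, hind, hw, hw1, hwz⟩ := eq_pos_convex_span_of_mem_convexHull hy
  choose p hpV hp using fun i => hz (Set.mem_range_self i)
  -- A `ℚ`-linear retraction of `ℝ` onto `ℚ`. Applied to the weights, it preserves every equation
  -- with rational coefficients.
  obtain ⟨φ, hφ⟩ := LinearMap.exists_leftInverse_of_injective (Algebra.linearMap ℚ ℝ)
    (LinearMap.ker_eq_bot.2 (algebraMap ℚ ℝ).injective)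
  have hφq : ∀ q : ℚ, φ (q : ℝ) = q := fun q => by
    simpa using LinearMap.congr_fun hφ q
  have hφm : ∀ (q : ℚ) (r : ℝ), φ (r * q) = φ r * q := fun q r => by
    have := map_smul φ q r
    rw [Rat.smul_def, mul_comm] at this
    rw [this, smul_eq_mul, mul_comm]
  have ht' : (t : ℝ) ≠ 0 := by exact_mod_cast ht.ne'
  have htq : (t : ℚ) ≠ 0 := by exact_mod_cast ht.ne'
  have hcoord : ∀ m, ∑ i, w i * (p i m : ℝ) = (x m : ℝ) / t := by
    intro m
    have h1 := congrFun hwz m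
    have h2 := congrFun hyx m
    simp only [Finset.sum_apply, Pi.smul_apply, smul_eq_mul, ← hp, latticeEmb_apply] at h1 h2
    rw [h1, ← h2]
    field_simp
  have hcoordq : ∀ m, ∑ i, φ (w i) * (p i m : ℚ) = (x m : ℚ) / t := by
    intro m
    have h := congrArg φ (hcoord m)
    rw [map_sum] at h
    have h3 : φ ((x m : ℝ) / t) = (x m : ℚ) / t := by
      rw [← hφq ((x m : ℚ) / t)]; push_cast; rfl
    rw [h3] at h
    rw [← h]
    refine Finset.sum_congr rfl fun i _ => ?_
    rw [← hφm]; push_cast; rfl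
  have hsumq : ∑ i, φ (w i) = 1 := by
    rw [← map_sum, hw1]
    simpa using hφq 1
  -- `w - φ ∘ w` is an affine relation among independent points, hence zero.
  have heq : ∀ i, w i = (φ (w i) : ℝ) := by
    have hz0 := affineIndependent_iff.1 hind Finset.univ (fun i => w i - (φ (w i) : ℝ))
      (by rw [Finset.sum_sub_distrib, hw1, ← Rat.cast_sum, hsumq]; simp)
      (by
        ext m
        simp only [Finset.sum_apply, Pi.smul_apply, smul_eq_mul, ← hp, latticeEmb_apply, sub_mul,
          Finset.sum_sub_distrib, Pi.zero_apply, hcoord]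
        have := congrArg (fun q : ℚ => (q : ℝ)) (hcoordq m)
        push_cast at this
        rw [this, sub_self])
    intro i
    exact sub_eq_zero.1 (hz0 i (Finset.mem_univ i))
  have hpos : ∀ i, 0 ≤ (t : ℚ) * φ (w i) := fun i => by
    have := hw i
    rw [heq i] at this
    have h : (0 : ℚ) < φ (w i) := by exact_mod_cast this
    positivity
  obtain ⟨k, hk, c, hc⟩ := exists_common_denominator _ hpos
  refine ⟨k, hk, fun v => ∑ i with (⟨p i, hpV i⟩ : V) = v, c i, ?_, ?_⟩
  · have h1 : ∑ v : V, (∑ i with (⟨p i, hpV i⟩ : V) = v, c i) • (v : Fin d → ℤ)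
        = ∑ i, c i • p i := by
      rw [← Finset.sum_fiberwise Finset.univ (fun i => (⟨p i, hpV i⟩ : V))]
      refine Finset.sum_congr rfl fun v _ => ?_
      rw [Finset.sum_smul]
      refine Finset.sum_congr rfl fun i hi => ?_
      rw [← (Finset.mem_filter.1 hi).2]
    rw [h1]
    ext m
    have h2 : ((∑ i, c i • p i) m : ℚ) = k * x m := by
      simp only [Finset.sum_apply, nsmul_eq_mul, Pi.mul_apply, Pi.natCast_apply]
      push_cast
      simp only [hc]
      have := hcoordq m
      field_simp at this
      rw [← this, Finset.sum_mul, Finset.mul_sum]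
      exact Finset.sum_congr rfl fun i _ => by ring
    have h3 : ((∑ i, c i • p i) m) = k * x m := by exact_mod_cast h2
    simpa using h3
  · rw [Finset.sum_fiberwise Finset.univ (fun i => (⟨p i, hpV i⟩ : V))]
    have : ((∑ i, c i : ℕ) : ℚ) = k * t := by
      push_cast
      simp only [hc]
      rw [← Finset.mul_sum, ← Finset.mul_sum, hsumq, mul_one]
    exact_mod_cast this

/-! ### Zonotopes and the reduction of their directions -/

/-- All vertices of the zonotope `a + ∑ v ∈ s, [0, v]` lie in `Q`. -/
def Fits {d : ℕ} (Q : Set (Fin d → ℝ)) (a : Fin d → ℤ) (s : Multiset (Fin d → ℤ)) : Prop :=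
  ∀ r ≤ s, latticeEmb d (a + r.sum) ∈ Q

theorem Fits.mono {d : ℕ} {Q : Set (Fin d → ℝ)} {a : Fin d → ℤ} {r s : Multiset (Fin d → ℤ)}
    (h : Fits Q a s) (hr : r ≤ s) : Fits Q a r := fun q hq => h q (hq.trans hr)

/-- The lattice vectors in `S` span at most `n` dimensions. -/
def RankLE {d : ℕ} (n : ℕ) (S : Set (Fin d → ℤ)) : Prop :=
  ∃ W : Submodule ℝ (Fin d → ℝ), Module.finrank ℝ W ≤ n ∧ ∀ v ∈ S, latticeEmb d v ∈ W

theorem RankLE.mono {d n : ℕ} {S T : Set (Fin d → ℤ)} (h : RankLE n T) (hST : S ⊆ T) :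
    RankLE n S :=
  let ⟨W, hW, hT⟩ := h
  ⟨W, hW, fun v hv => hT v (hST hv)⟩

/-- Corners with zero or two copies of `u` are old corners; a corner with one copy is the midpoint
of these two. -/
theorem Fits.replace_pair {d : ℕ} {Q : Set (Fin d → ℝ)} (hQ : Convex ℝ Q) {a u v w : Fin d → ℤ}
    {r : Multiset (Fin d → ℤ)} (h : Fits Q a (v ::ₘ w ::ₘ r)) (hu : v + w = u + u) :
    Fits Q a (u ::ₘ u ::ₘ r) := by
  classical
  intro q hq
  have key : ∀ q' ≤ r, latticeEmb d (a + q'.sum) ∈ Q ∧ latticeEmb d (a + (u + q'.sum)) ∈ Q ∧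
      latticeEmb d (a + (u + (u + q'.sum))) ∈ Q := by
    intro q' hq'
    have h0 : latticeEmb d (a + q'.sum) ∈ Q :=
      h q' (hq'.trans ((Multiset.le_cons_self r w).trans (Multiset.le_cons_self _ v)))
    have h2 : latticeEmb d (a + (u + (u + q'.sum))) ∈ Q := by
      have := h (v ::ₘ w ::ₘ q') (Multiset.cons_le_cons v (Multiset.cons_le_cons w hq'))
      rw [Multiset.sum_cons, Multiset.sum_cons, ← add_assoc v, hu, add_assoc u] at this
      exact this
    refine ⟨h0, ?_, h2⟩
    convert hQ h0 h2 (a := 1 / 2) (b := 1 / 2) (by norm_num) (by norm_num) (by norm_num) using 1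
    ext i
    simp
    ring
  by_cases h1 : u ∈ q
  · obtain ⟨q₁, rfl⟩ := Multiset.exists_cons_of_mem h1
    have hq₁ := (Multiset.cons_le_cons_iff u).1 hq
    by_cases h2 : u ∈ q₁
    · obtain ⟨q₂, rfl⟩ := Multiset.exists_cons_of_mem h2
      simpa using (key q₂ ((Multiset.cons_le_cons_iff u).1 hq₁)).2.2
    · simpa using (key q₁ ((Multiset.le_cons_of_notMem h2).1 hq₁)).2.1
  · exact (key q ((Multiset.le_cons_of_notMem h1).1 ((Multiset.le_cons_of_notMem h1).1 hq))).1

/-- The square of the Euclidean norm. -/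
def normSq {d : ℕ} (v : Fin d → ℤ) : ℕ := ∑ i, (v i).natAbs ^ 2

theorem coe_normSq {d : ℕ} (v : Fin d → ℤ) : (normSq v : ℤ) = ∑ i, v i ^ 2 := by
  simp [normSq]

theorem normSq_pos {d : ℕ} {v : Fin d → ℤ} (hv : v ≠ 0) : 0 < normSq v := by
  obtain ⟨i, hi⟩ := Function.ne_iff.1 hv
  refine Finset.sum_pos' (fun _ _ => Nat.zero_le _) ⟨i, Finset.mem_univ i, ?_⟩
  have : 0 < (v i).natAbs := Int.natAbs_pos.2 hi
  positivity

/-- Parallelogram law: `|v|² + |w|² = 2|u|² + 2|u - w|²`. This makes the halving process terminate.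
-/
theorem normSq_lt_of_add_eq {d : ℕ} {u v w : Fin d → ℤ} (hu : v + w = u + u) (hvw : v ≠ w) :
    normSq u + normSq u < normSq v + normSq w := by
  have h1 : 0 < normSq (u - w) := normSq_pos fun h => hvw <| by
    have h' := sub_eq_zero.1 h
    rw [h'] at hu
    exact add_right_cancel hu
  zify at h1 ⊢
  simp only [coe_normSq] at h1 ⊢
  have h2 : ∑ i, v i ^ 2 + ∑ i, w i ^ 2 =
      ∑ i, u i ^ 2 + ∑ i, u i ^ 2 + 2 * ∑ i, (u - w) i ^ 2 := by
    rw [Finset.mul_sum, ← Finset.sum_add_distrib, ← Finset.sum_add_distrib,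
      ← Finset.sum_add_distrib]
    refine Finset.sum_congr rfl fun i _ => ?_
    have := congrFun hu i
    simp only [Pi.add_apply, Pi.sub_apply] at this ⊢
    have h3 : v i = u i + u i - w i := by omega
    rw [h3]
    ring
  omega

/-- Some class mod 2 contains three of the vectors, and a vector has only one negative, so two of
the three are not opposite. Excluding `v = -w` keeps the midpoint `u` nonzero. -/
theorem exists_congruent_pair {d : ℕ} (T : Finset (Fin d → ℤ)) (hT : 2 * 2 ^ d < T.card) :
    ∃ v ∈ T, ∃ w ∈ T, v ≠ w ∧ v ≠ -w ∧ ∃ u, v + w = u + u := by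
  classical
  have hpair : ∀ v w : Fin d → ℤ, (fun i => (v i : ZMod 2)) = (fun i => (w i : ZMod 2)) →
      ∃ u, v + w = u + u := by
    intro v w h
    refine ⟨fun i => (v i + w i) / 2, ?_⟩
    ext i
    have h1 := congrFun h i
    rw [ZMod.intCast_eq_intCast_iff_dvd_sub] at h1
    simp only [Pi.add_apply]
    push_cast at h1
    omega
  obtain ⟨y, -, hy⟩ := Finset.exists_lt_card_fiber_of_mul_lt_card_of_maps_to (s := T)
    (t := (Finset.univ : Finset (Fin d → ZMod 2))) (f := fun v i => (v i : ZMod 2)) (n := 2)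
    (fun _ _ => Finset.mem_univ _) (by simpa [ZMod.card, mul_comm] using hT)
  obtain ⟨v, hv, w, hw, z, hz, hvw, hvz, hwz⟩ := Finset.two_lt_card.1 hy
  rw [Finset.mem_filter] at hv hw hz
  by_cases h : v = -w
  · refine ⟨v, hv.1, z, hz.1, hvz, fun h' => hwz ?_, hpair v z (hv.2.trans hz.2.symm)⟩
    exact neg_injective (h.symm.trans h')
  · exact ⟨v, hv.1, w, hw.1, hvw, h, hpair v w (hv.2.trans hw.2.symm)⟩

/-- Every zonotope in a convex set can be replaced by one with the same number of summands and a
bounded number of directions. -/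
theorem Fits.exists_few_directions {d n : ℕ} {Q : Set (Fin d → ℝ)} (hQ : Convex ℝ Q)
    {a : Fin d → ℤ} {s : Multiset (Fin d → ℤ)} (h : Fits Q a s) (h0 : (0 : Fin d → ℤ) ∉ s)
    (hn : RankLE n {v | v ∈ s}) :
    ∃ s' : Multiset (Fin d → ℤ), Fits Q a s' ∧ 0 ∉ s' ∧ RankLE n {v | v ∈ s'} ∧
      s'.card = s.card ∧ s'.toFinset.card ≤ 2 * 2 ^ d := by
  classical
  induction hN : (s.map normSq).sum using Nat.strong_induction_on generalizing s with
  | _ N ih =>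
    by_cases hc : s.toFinset.card ≤ 2 * 2 ^ d
    · exact ⟨s, h, h0, hn, rfl, hc⟩
    obtain ⟨v, hv, w, hw, hvw, hvw', u, hu⟩ := exists_congruent_pair s.toFinset (not_le.1 hc)
    rw [Multiset.mem_toFinset] at hv hw
    obtain ⟨s₁, rfl⟩ := Multiset.exists_cons_of_mem hv
    obtain ⟨r, rfl⟩ := Multiset.exists_cons_of_mem
      ((Multiset.mem_cons.1 hw).resolve_left hvw.symm)
    have hu0 : u ≠ 0 := by
      rintro rfl
      exact hvw' (eq_neg_of_add_eq_zero_left (by simpa using hu))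
    have hlt := normSq_lt_of_add_eq hu hvw
    obtain ⟨W, hW, hWs⟩ := hn
    have hWs' : ∀ x ∈ v ::ₘ w ::ₘ r, latticeEmb d x ∈ W := fun x hx => hWs x hx
    have huW : latticeEmb d u ∈ W := by
      have h1 : latticeEmb d u + latticeEmb d u ∈ W := by
        rw [← map_add, ← hu, map_add]
        exact W.add_mem (hWs' v (by simp)) (hWs' w (by simp))
      rw [← two_smul ℝ] at h1
      exact (W.smul_mem_iff two_ne_zero).1 h1
    obtain ⟨s', h1, h2, h3, h4, h5⟩ := ih _ (by
      rw [← hN]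
      show ((u ::ₘ u ::ₘ r).map normSq).sum < _
      simp only [Multiset.map_cons, Multiset.sum_cons]
      omega) (h.replace_pair hQ hu)
      (by
        simp only [Multiset.mem_cons, not_or] at h0 ⊢
        exact ⟨hu0.symm, hu0.symm, h0.2.2⟩)
      ⟨W, hW, by
        intro x hx
        have hx' : x ∈ u ::ₘ u ::ₘ r := hx
        simp only [Multiset.mem_cons] at hx'
        rcases hx' with rfl | rfl | hx'
        · exact huW
        · exact huW
        · exact hWs' x (by simp [hx'])⟩ rfl
    exact ⟨s', h1, h2, h3, by simpa using h4, h5⟩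

/-! ### Bounds on edge lengths -/

/-- The `ℓ¹`-norm. -/
def normOne {d : ℕ} (v : Fin d → ℤ) : ℕ := ∑ i, (v i).natAbs

theorem normOne_pos {d : ℕ} {v : Fin d → ℤ} (hv : v ≠ 0) : 0 < normOne v := by
  obtain ⟨i, hi⟩ := Function.ne_iff.1 hv
  exact Finset.sum_pos' (fun _ _ => Nat.zero_le _)
    ⟨i, Finset.mem_univ i, Int.natAbs_pos.2 hi⟩

theorem finite_normOne_le (d B : ℕ) : {v : Fin d → ℤ | normOne v ≤ B}.Finite := by
  refine (Set.Finite.pi' (ι := Fin d) (t := fun _ => Set.Icc (-(B : ℤ)) B)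
    fun _ => Set.finite_Icc _ _).subset fun v hv => ?_
  have hv' : normOne v ≤ B := hv
  intro i
  have h1 : (v i).natAbs ≤ normOne v :=
    Finset.single_le_sum (f := fun i => (v i).natAbs) (fun _ _ => Nat.zero_le _)
      (Finset.mem_univ i)
  rw [Set.mem_Icc]
  omega

/-- The total length of the summands of a zonotope is bounded by the size of its container. -/
theorem Fits.sum_normOne_le {d b : ℕ} {Q : Set (Fin d → ℝ)}
    (hQ : ∀ z, latticeEmb d z ∈ Q → ∀ i, |z i| ≤ b) {a : Fin d → ℤ}
    {s : Multiset (Fin d → ℤ)} (h : Fits Q a s) : (s.map normOne).sum ≤ d * (2 * b) := by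
  classical
  have hcoord : ∀ i, (s.map fun v => (v i).natAbs).sum ≤ 2 * b := by
    intro i
    -- The two corners extremal in direction `i` differ there by the sum of all `|v i|`.
    have h1 := abs_le.1 (hQ _ (h _ (Multiset.filter_le (fun v => 0 ≤ v i) s)) i)
    have h2 := abs_le.1 (hQ _ (h _ (Multiset.filter_le (fun v => ¬ 0 ≤ v i) s)) i)
    have hsum : ∀ r : Multiset (Fin d → ℤ), r.sum i = (r.map fun v => v i).sum := fun r =>
      map_multiset_sum (Pi.evalAddMonoidHom (fun _ : Fin d => ℤ) i) r
    simp only [Pi.add_apply, hsum] at h1 h2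
    have h3 : (((s.map fun v => (v i).natAbs).sum : ℕ) : ℤ) =
        ((s.filter fun v => 0 ≤ v i).map fun v => v i).sum -
          ((s.filter fun v => ¬ 0 ≤ v i).map fun v => v i).sum := by
      clear h h1 h2
      induction s using Multiset.induction_on with
      | empty => simp
      | cons v s ih =>
        by_cases hv : 0 ≤ v i
        · have hv' : ¬ v i < 0 := not_lt.2 hv
          simp [hv, hv', abs_of_nonneg hv] at ih ⊢
          omega
        · have hv' : v i < 0 := not_le.1 hv
          simp [hv, hv', abs_of_neg hv'] at ih ⊢
          omega
    omega
  have hswap : (s.map normOne).sum = ∑ i, (s.map fun v => (v i).natAbs).sum := by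
    clear h hcoord
    induction s using Multiset.induction_on with
    | empty => simp
    | cons v s ih => simp [ih, Finset.sum_add_distrib, normOne]
  calc (s.map normOne).sum = ∑ i, (s.map fun v => (v i).natAbs).sum := hswap
    _ ≤ ∑ _i : Fin d, 2 * b := Finset.sum_le_sum fun i _ => hcoord i
    _ = d * (2 * b) := by simp

/-! ### Zonotopes with directions in a fixed finite set -/

/-- Grouping parallel edges leaves only the corners that use all or none of the copies of each
direction. Intermediate multiplicities follow by interpolating one direction at a time. -/
theorem mem_of_corners_mem {d : ℕ} {Q : Set (Fin d → ℝ)} (hQ : Convex ℝ Q) {D : Type*}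
    [DecidableEq D] (e : D → Fin d → ℤ) (a : Fin d → ℤ) (m j : D → ℕ) (hj : ∀ u, j u ≤ m u)
    (h : ∀ I : Finset D, latticeEmb d (a + ∑ u ∈ I, m u • e u) ∈ Q) (J I : Finset D)
    (hIJ : Disjoint I J) :
    latticeEmb d (a + (∑ u ∈ I, m u • e u + ∑ u ∈ J, j u • e u)) ∈ Q := by
  induction J using Finset.induction_on generalizing I with
  | empty => simpa using h I
  | insert u J hu ih =>
    have hI : Disjoint I J := hIJ.mono_right (Finset.subset_insert u J)
    have huI : u ∉ I := fun hmem => Finset.disjoint_left.1 hIJ hmem (Finset.mem_insert_self u J)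
    rcases Nat.eq_zero_or_pos (m u) with hm | hm
    · have hj0 : j u = 0 := by have := hj u; omega
      rw [Finset.sum_insert hu, hj0, zero_smul, zero_add]
      exact ih I hI
    have h0 := ih I hI
    have h1 := ih (insert u I) (Finset.disjoint_insert_left.2 ⟨hu, hI⟩)
    have hm' : (0 : ℝ) < m u := by exact_mod_cast hm
    have hju : (j u : ℝ) ≤ m u := by exact_mod_cast hj u
    have := hQ h0 h1 (a := 1 - (j u : ℝ) / m u) (b := (j u : ℝ) / m u)
      (by rw [sub_nonneg, div_le_one hm']; exact hju) (by positivity) (by ring)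
    convert this using 1
    rw [Finset.sum_insert hu, Finset.sum_insert huI]
    ext i
    simp
    field_simp
    ring

theorem sum_mem_of_le {d : ℕ} (D : Finset (Fin d → ℤ)) {r : Multiset (Fin d → ℤ)}
    (hr : ∀ v ∈ r, v ∈ D) : r.sum = ∑ u : D, r.count (u : Fin d → ℤ) • (u : Fin d → ℤ) := by
  classical
  rw [Finset.sum_multiset_count_of_subset r D (fun v hv => hr v (Multiset.mem_toFinset.1 hv)),
    ← Finset.sum_coe_sort]

/-- Among the zonotopes with directions in a finite set `D` that are contained in a dilate of a
lattice polytope, one has the largest number of summands relative to the dilation factor. -/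
theorem exists_max_of_finite_directions {d : ℕ} {V : Finset (Fin d → ℤ)} (hV : V.Nonempty)
    {D : Finset (Fin d → ℤ)} (hD : 0 ∉ D) :
    ∃ t : ℕ, 0 < t ∧ ∃ a s, (∀ v ∈ s, v ∈ D) ∧
      Fits ((t : ℝ) • convexHull ℝ (latticeEmb d '' (V : Set (Fin d → ℤ)))) a s ∧
      ∀ t' : ℕ, 0 < t' → ∀ a' s', (∀ v ∈ s', v ∈ D) →
        Fits ((t' : ℝ) • convexHull ℝ (latticeEmb d '' (V : Set (Fin d → ℤ)))) a' s' →
        s'.card * t ≤ s.card * t' := by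
  classical
  set P := convexHull ℝ (latticeEmb d '' (V : Set (Fin d → ℤ))) with hP
  -- Unknowns of the system: the dilation factor, the multiplicity of each direction, and for each
  -- corner `I ⊆ D` the weights expressing it through the vertices.
  let κ := Unit ⊕ D ⊕ (Finset D × V)
  let tt : κ := Sum.inl ()
  let mm : D → κ := fun u => Sum.inr (Sum.inl u)
  let cc : Finset D → V → κ := fun I p => Sum.inr (Sum.inr (I, p))
  -- The base point `a` stays outside the unknowns: it ranges over all of `ℤ^d`, so differences of
  -- solutions are again solutions.
  let Sol : (κ → ℕ) → (Fin d → ℤ) → Prop := fun x a => ∀ I : Finset D,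
    ∑ p : V, x (cc I p) • (p : Fin d → ℤ) = a + ∑ u ∈ I, x (mm u) • (u : Fin d → ℤ) ∧
    ∑ p : V, x (cc I p) = x tt
  let X : Set (κ → ℕ) := {x | ∃ a, Sol x a}
  have hXm : ∀ {x}, x ∈ X ↔ ∃ a, Sol x a := by intro x; simp [X]
  let f : (κ → ℕ) →+ ℕ := ∑ u : D, Pi.evalAddMonoidHom (fun _ : κ => ℕ) (mm u)
  let g : (κ → ℕ) →+ ℕ := Pi.evalAddMonoidHom (fun _ : κ => ℕ) tt
  have hf : ∀ x, f x = ∑ u : D, x (mm u) := fun x => by simp [f]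
  have hg : ∀ x, g x = x tt := fun x => rfl
  have hXsub : ∀ x ∈ X, ∀ y ∈ X, x ≤ y → y - x ∈ X := by
    intro x hx y hy hxy
    obtain ⟨a, ha⟩ := hXm.1 hx
    obtain ⟨b, hb⟩ := hXm.1 hy
    obtain ⟨z, rfl⟩ := exists_add_of_le hxy
    rw [add_tsub_cancel_left]
    refine hXm.2 ⟨b - a, fun I => ?_⟩
    obtain ⟨a1, a2⟩ := ha I
    obtain ⟨b1, b2⟩ := hb I
    simp only [Pi.add_apply, add_smul, Finset.sum_add_distrib] at b1 b2
    rw [a1] at b1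
    rw [a2] at b2
    refine ⟨?_, Nat.add_left_cancel b2⟩
    have : ∀ A B S Z W : Fin d → ℤ, A + S + Z = B + (S + W) → Z = B - A + W := by
      intro A B S Z W h
      have h' : Z = B + (S + W) - (A + S) := by rw [← h]; abel
      rw [h']; abel
    exact this _ _ _ _ _ b1
  have hXfg : ∀ x ∈ X, g x = 0 → f x = 0 := by
    intro x hx hx0
    obtain ⟨a, ha⟩ := hXm.1 hx
    rw [hg] at hx0
    have hc : ∀ I, a + ∑ u ∈ I, x (mm u) • (u : Fin d → ℤ) = 0 := by
      intro I
      obtain ⟨h1, h2⟩ := ha I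
      rw [hx0] at h2
      rw [← h1]
      refine Finset.sum_eq_zero fun p hp => ?_
      rw [Finset.sum_eq_zero_iff.1 h2 p hp, zero_smul]
    have ha0 : a = 0 := by simpa using hc ∅
    rw [hf]
    refine Finset.sum_eq_zero fun u _ => ?_
    have h1 := hc {u}
    rw [ha0, zero_add, Finset.sum_singleton, smul_eq_zero] at h1
    exact h1.resolve_right fun h => hD (h ▸ u.2)
  have hXne : ∃ x ∈ X, 0 < g x := by
    obtain ⟨p₀, hp₀⟩ := hV
    refine ⟨Sum.elim (fun _ => 1) (Sum.elim (fun _ => 0)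
      (fun Ip => if Ip.2 = ⟨p₀, hp₀⟩ then 1 else 0)), hXm.2 ⟨p₀, fun I => ?_⟩, Nat.one_pos⟩
    simp [cc, mm, tt, ite_smul]
  obtain ⟨x, hx, hgx, hmax⟩ := exists_max_ratio X hXsub f g hXfg hXne
  obtain ⟨a, ha⟩ := hXm.1 hx
  rw [hg] at hgx
  set s : Multiset (Fin d → ℤ) := ∑ u : D, Multiset.replicate (x (mm u)) (u : Fin d → ℤ) with hs
  have hscount : ∀ u : D, s.count (u : Fin d → ℤ) = x (mm u) := by
    intro u
    rw [hs, Multiset.count_sum', Finset.sum_eq_single u]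
    · exact Multiset.count_replicate_self _ _
    · intro w _ hwu
      rw [Multiset.count_replicate, if_neg fun h => hwu (Subtype.ext h)]
    · exact fun h => absurd (Finset.mem_univ u) h
  have hsD : ∀ v ∈ s, v ∈ D := by
    intro v hv
    obtain ⟨u, -, hu⟩ := Multiset.mem_sum.1 hv
    rw [Multiset.eq_of_mem_replicate hu]
    exact u.2
  have hscard : s.card = f x := by
    rw [hf, hs, Multiset.card_sum]
    simp
  have hconv : Convex ℝ ((x tt : ℝ) • P) := (convex_convexHull ℝ _).smul _
  refine ⟨x tt, hgx, a, s, hsD, ?_, ?_⟩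
  · have hcorner : ∀ I : Finset D,
        latticeEmb d (a + ∑ u ∈ I, x (mm u) • (u : Fin d → ℤ)) ∈ (x tt : ℝ) • P := by
      intro I
      obtain ⟨h1, h2⟩ := ha I
      have hT : (0 : ℝ) < x tt := by exact_mod_cast hgx
      rw [← h1]
      refine ⟨∑ p : V, ((x (cc I p) : ℝ) / x tt) • latticeEmb d p, ?_, ?_⟩
      · refine (convex_convexHull ℝ _).sum_mem (fun p _ => by positivity) ?_
          fun p _ => subset_convexHull ℝ _ ⟨p, p.2, rfl⟩
        rw [← Finset.sum_div, ← Nat.cast_sum, h2, div_self hT.ne']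
      · simp only [Finset.smul_sum, map_sum, map_nsmul]
        refine Finset.sum_congr rfl fun p _ => ?_
        rw [smul_smul, mul_div_cancel₀ _ hT.ne', Nat.cast_smul_eq_nsmul]
    intro r hr
    rw [sum_mem_of_le D fun v hv => hsD v (Multiset.mem_of_le hr hv)]
    have := mem_of_corners_mem hconv (fun u : D => (u : Fin d → ℤ)) a (fun u => x (mm u))
      (fun u => r.count (u : Fin d → ℤ))
      (fun u => by rw [← hscount]; exact Multiset.count_le_of_le _ hr) hcorner Finset.univ ∅
      (Finset.disjoint_empty_left _)
    simpa using this
  · intro t' ht' a' s' hs'D hfit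
    have hw : ∀ I : Finset D, ∃ k : ℕ, 0 < k ∧ ∃ c : V → ℕ,
        ∑ p, c p • (p : Fin d → ℤ) =
          k • (a' + ∑ u ∈ I, s'.count (u : Fin d → ℤ) • (u : Fin d → ℤ)) ∧
        ∑ p, c p = k * t' := by
      intro I
      refine exists_nat_weights V _ ht' ?_
      have := hfit (∑ u ∈ I, Multiset.replicate (s'.count (u : Fin d → ℤ)) (u : Fin d → ℤ)) (by
        rw [Multiset.le_iff_count]
        intro v
        rw [Multiset.count_sum']
        by_cases hv : v ∈ D
        · calc _ ≤ ∑ u ∈ I, if u = ⟨v, hv⟩ then s'.count v else 0 := by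
                refine Finset.sum_le_sum fun u _ => ?_
                rw [Multiset.count_replicate]
                by_cases huv : (u : Fin d → ℤ) = v
                · simp [huv, Subtype.ext_iff]
                · simp [huv]
            _ ≤ _ := by
                rw [Finset.sum_ite_eq']
                split_ifs <;> simp
        · rw [Finset.sum_eq_zero]
          · exact Nat.zero_le _
          · intro u _
            rw [Multiset.count_replicate, if_neg]
            rintro rfl
            exact hv u.2)
      rw [Multiset.sum_sum] at this
      simpa using this
    choose k hk c hc1 hc2 using hw
    -- A zonotope in `t'P` yields integral weights only after scaling. Scaling all corners by the
    -- common multiple `K` gives a solution with the same ratio.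
    let K := ∏ I, k I
    have hK : 0 < K := Finset.prod_pos fun I _ => hk I
    let L : Finset D → ℕ := fun I => ∏ J ∈ Finset.univ.erase I, k J
    have hL : ∀ I, L I * k I = K := fun I => Finset.prod_erase_mul _ _ (Finset.mem_univ I)
    have hy := hmax (Sum.elim (fun _ => K * t') (Sum.elim
      (fun u => K * s'.count (u : Fin d → ℤ)) (fun Ip => L Ip.1 * c Ip.1 Ip.2)))
      (hXm.2 ⟨K • a', fun I => by
        simp only [cc, mm, tt, Sum.elim_inl, Sum.elim_inr, mul_smul]
        rw [← Finset.smul_sum, ← Finset.smul_sum, ← Finset.mul_sum, hc1, hc2, ← mul_smul,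
          ← mul_assoc, hL, smul_add]
        exact ⟨rfl, rfl⟩⟩)
    rw [hf, hg, hg] at hy
    simp only [mm, tt, Sum.elim_inl, Sum.elim_inr] at hy
    rw [← Finset.mul_sum] at hy
    have hcard : s'.card = ∑ u : D, s'.count (u : Fin d → ℤ) := by
      rw [Finset.sum_coe_sort D (fun v => s'.count v)]
      exact (Multiset.sum_count_eq_card hs'D).symm
    rw [hcard, hscard]
    refine le_of_mul_le_mul_left (a := K) ?_ hK
    calc _ = _ := by rw [← mul_assoc]
      _ ≤ _ := hy
      _ = _ := by ring

/-! ### Existence of a maximal ratio -/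

/-- `c = (t, s)` describes a zonotope of dimension at most `n` in the `t`-th dilate of `P`. -/
def IsConfig {d : ℕ} (n : ℕ) (P : Set (Fin d → ℝ)) (c : ℕ × Multiset (Fin d → ℤ)) : Prop :=
  0 < c.1 ∧ 0 ∉ c.2 ∧ RankLE n {v | v ∈ c.2} ∧ ∃ a, Fits ((c.1 : ℝ) • P) a c.2

/-- The number of summands relative to the dilation factor. -/
def ratio {d : ℕ} (c : ℕ × Multiset (Fin d → ℤ)) : ℚ := (c.2.card : ℚ) / c.1

theorem card_eq_ratio_mul {d : ℕ} {c : ℕ × Multiset (Fin d → ℤ)} (hc : 0 < c.1) :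
    (c.2.card : ℚ) = ratio c * c.1 := by
  have : (c.1 : ℚ) ≠ 0 := by exact_mod_cast hc.ne'
  rw [ratio, div_mul_cancel₀ _ this]

theorem exists_coord_bound {d : ℕ} (V : Finset (Fin d → ℤ)) :
    ∃ b : ℕ, ∀ t : ℕ, ∀ z,
      latticeEmb d z ∈ (t : ℝ) • convexHull ℝ (latticeEmb d '' (V : Set (Fin d → ℤ))) →
      ∀ i, |z i| ≤ ((t * b : ℕ) : ℤ) := by
  refine ⟨V.sup normOne, fun t z hz i => ?_⟩
  obtain ⟨y, hy, hyz⟩ := hz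
  have hsub : convexHull ℝ (latticeEmb d '' (V : Set (Fin d → ℤ))) ⊆
      {x | |x i| ≤ ((V.sup normOne : ℕ) : ℝ)} := by
    refine convexHull_min ?_ ?_
    · rintro _ ⟨v, hv, rfl⟩
      have h1 : (v i).natAbs ≤ normOne v :=
        Finset.single_le_sum (f := fun i => (v i).natAbs) (fun _ _ => Nat.zero_le _)
          (Finset.mem_univ i)
      have h2 : normOne v ≤ V.sup normOne := Finset.le_sup hv
      have h3 : |v i| ≤ ((V.sup normOne : ℕ) : ℤ) := by
        rw [abs_le]
        omega
      show |(v i : ℝ)| ≤ _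
      exact_mod_cast h3
    · have h : Convex ℝ (Set.Icc (-((V.sup normOne : ℕ) : ℝ)) (V.sup normOne : ℕ)) :=
        convex_Icc _ _
      convert h.linear_preimage (LinearMap.proj (R := ℝ) (φ := fun _ : Fin d => ℝ) i) using 1
      ext x
      simp [abs_le]
  have hyi : |y i| ≤ ((V.sup normOne : ℕ) : ℝ) := hsub hy
  have h1 : (z i : ℝ) = t * y i := (congrFun hyz i).symm
  have h2 : |(z i : ℝ)| ≤ ((t * V.sup normOne : ℕ) : ℝ) := by
    rw [h1, abs_mul, Nat.abs_cast]
    push_cast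
    gcongr
  exact_mod_cast h2

theorem exists_length_bound {d n : ℕ} (V : Finset (Fin d → ℤ)) :
    ∃ C : ℕ, ∀ c, IsConfig n (convexHull ℝ (latticeEmb d '' (V : Set (Fin d → ℤ)))) c →
      (c.2.map normOne).sum ≤ C * c.1 := by
  obtain ⟨b, hb⟩ := exists_coord_bound V
  refine ⟨d * (2 * b), fun c hc => ?_⟩
  obtain ⟨-, -, -, a, ha⟩ := hc
  calc _ ≤ _ := ha.sum_normOne_le (hb c.1)
    _ = _ := by ring

theorem sum_normOne_mono {d : ℕ} {r s : Multiset (Fin d → ℤ)} (h : r ≤ s) :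
    (r.map normOne).sum ≤ (s.map normOne).sum := by
  obtain ⟨q, rfl⟩ := Multiset.le_iff_exists_add.1 h
  simp

theorem card_mul_le_sum_normOne {d B : ℕ} (s : Multiset (Fin d → ℤ))
    (h : ∀ v ∈ s, B ≤ normOne v) : s.card * B ≤ (s.map normOne).sum := by
  have := Multiset.card_nsmul_le_sum (s := s.map normOne) (a := B) (by
    intro x hx
    obtain ⟨v, hv, rfl⟩ := Multiset.mem_map.1 hx
    exact h v hv)
  simpa using this

theorem IsConfig.zero {d n : ℕ} {V : Finset (Fin d → ℤ)} (hV : V.Nonempty) :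
    IsConfig n (convexHull ℝ (latticeEmb d '' (V : Set (Fin d → ℤ)))) (1, 0) := by
  obtain ⟨p, hp⟩ := hV
  refine ⟨Nat.one_pos, by simp, ⟨⊥, by simp, by simp⟩, p, fun r hr => ?_⟩
  have : r = 0 := Multiset.le_zero.1 hr
  subst this
  simpa using subset_convexHull ℝ _ (Set.mem_image_of_mem (latticeEmb d) hp)

/-- The number of summands relative to the dilation factor has a maximum. -/
theorem exists_max_config {d n : ℕ} {V : Finset (Fin d → ℤ)} (hV : V.Nonempty) :
    ∃ c, IsConfig n (convexHull ℝ (latticeEmb d '' (V : Set (Fin d → ℤ)))) c ∧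
      ∀ c', IsConfig n (convexHull ℝ (latticeEmb d '' (V : Set (Fin d → ℤ)))) c' →
        ratio c' ≤ ratio c := by
  classical
  set P := convexHull ℝ (latticeEmb d '' (V : Set (Fin d → ℤ))) with hP
  by_contra! hno
  -- `D` is cofinal: every ratio is beaten by a zonotope with few directions that uses all of `D`.
  let Cof : Finset (Fin d → ℤ) → Prop := fun D => ∀ c, IsConfig n P c →
    ∃ c', IsConfig n P c' ∧ D ⊆ c'.2.toFinset ∧ c'.2.toFinset.card ≤ 2 * 2 ^ d ∧
      ratio c < ratio c'
  obtain ⟨C, hC⟩ := exists_length_bound (n := n) V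
  have hstart : Cof ∅ := by
    intro c hc
    obtain ⟨c', ⟨ht, h0, hn, a, ha⟩, hlt⟩ := hno c hc
    obtain ⟨s, h1, h2, h3, h4, h5⟩ := ha.exists_few_directions
      ((convex_convexHull ℝ _).smul _) h0 hn
    refine ⟨(c'.1, s), ⟨ht, h2, h3, a, h1⟩, by simp, h5, ?_⟩
    have : ratio (c'.1, s) = ratio c' := by simp only [ratio, h4]
    rwa [this]
  have hstep : ∀ D, Cof D → ∃ v ∉ D, Cof (insert v D) := by
    intro D hD
    by_contra! hbad
    -- A configuration using all of `D` shows that `0 ∉ D` and that `D` has rank at most `n`, so the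
    -- optimum over `D` is itself a configuration.
    obtain ⟨c₂, hc₂, hDc₂, -, -⟩ := hD _ (IsConfig.zero hV)
    have hDmem : ∀ v ∈ D, v ∈ c₂.2 := fun v hv => Multiset.mem_toFinset.1 (hDc₂ hv)
    obtain ⟨t₀, ht₀, a₀, s₀, hs₀, hfit₀, hmax₀⟩ := exists_max_of_finite_directions hV
      (D := D) fun h => hc₂.2.1 (hDmem 0 h)
    have hc₀ : IsConfig n P (t₀, s₀) :=
      ⟨ht₀, fun h => hc₂.2.1 (hDmem 0 (hs₀ 0 h)),
        hc₂.2.2.1.mono fun v hv => hDmem v (hs₀ v hv), a₀, hfit₀⟩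
    obtain ⟨c₁, hc₁, h01⟩ := hno _ hc₀
    -- `B` is chosen so that edges of length at least `B`, of which there are at most `C * t / B`,
    -- cannot make up the gap `ratio c₁ - ratio (t₀, s₀)`.
    obtain ⟨B, hB⟩ := exists_nat_gt ((C : ℚ) / (ratio c₁ - ratio (t₀, s₀)))
    rw [div_lt_iff₀ (sub_pos.2 h01)] at hB
    have hbad' : ∀ v, ∃ c, IsConfig n P c ∧ (v ∉ D → ∀ c', IsConfig n P c' →
        insert v D ⊆ c'.2.toFinset → c'.2.toFinset.card ≤ 2 * 2 ^ d → ratio c' ≤ ratio c) := by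
      intro v
      by_cases hv : v ∈ D
      · exact ⟨c₁, hc₁, fun h => absurd hv h⟩
      · have := hbad v hv
        simp only [Cof, not_forall, not_exists, not_and, not_lt] at this
        obtain ⟨c, hc, h⟩ := this
        exact ⟨c, hc, fun _ => h⟩
    choose cv hcv hcvmax using hbad'
    -- Only finitely many directions are short. A competitor that beats `c` and uses `D` therefore
    -- has only long edges outside `D`.
    obtain ⟨c, hcmem, hcmax⟩ := Finset.exists_max_image
      (insert c₁ ((finite_normOne_le d B).toFinset.image cv)) ratio (Finset.insert_nonempty _ _)
    have hc : IsConfig n P c := by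
      rcases Finset.mem_insert.1 hcmem with rfl | h
      · exact hc₁
      · obtain ⟨v, -, rfl⟩ := Finset.mem_image.1 h
        exact hcv v
    obtain ⟨c', hc', hDc', hcard, hlt⟩ := hD c hc
    have hlong : ∀ v ∈ c'.2.filter (fun v => v ∉ D), B ≤ normOne v := by
      intro v hv
      rw [Multiset.mem_filter] at hv
      by_contra! hvB
      have h1 := hcvmax v hv.2 c' hc' (Finset.insert_subset_iff.2
        ⟨Multiset.mem_toFinset.2 hv.1, hDc'⟩) hcard
      have h2 := hcmax (cv v) (Finset.mem_insert_of_mem (Finset.mem_image_of_mem _ (by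
        rw [Set.Finite.mem_toFinset]
        exact hvB.le)))
      exact absurd hlt (not_lt.2 (h1.trans h2))
    have hlt₁ : ratio c₁ < ratio c' := (hcmax c₁ (Finset.mem_insert_self _ _)).trans_lt hlt
    obtain ⟨ht', -, -, a', ha'⟩ := id hc'
    have h1 := hmax₀ c'.1 ht' a' (c'.2.filter (fun v => v ∈ D))
      (fun v hv => (Multiset.mem_filter.1 hv).2) (ha'.mono (Multiset.filter_le _ _))
    have h2 : ((c'.2.filter (fun v => v ∈ D)).card : ℚ) ≤ ratio (t₀, s₀) * c'.1 := by
      have ht₀' : (0 : ℚ) < t₀ := by exact_mod_cast ht₀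
      rw [ratio, div_mul_eq_mul_div, le_div_iff₀ ht₀']
      exact_mod_cast h1
    have h3 : ((c'.2.filter (fun v => v ∉ D)).card : ℚ) =
        ratio c' * c'.1 - (c'.2.filter (fun v => v ∈ D)).card := by
      rw [← card_eq_ratio_mul ht']
      have := congrArg Multiset.card (Multiset.filter_add_not (fun v => v ∈ D) c'.2)
      rw [Multiset.card_add] at this
      rw [← this]
      push_cast
      ring
    have h4 : (c'.2.filter (fun v => v ∉ D)).card * B ≤ C * c'.1 :=
      (card_mul_le_sum_normOne _ hlong).trans
        ((sum_normOne_mono (Multiset.filter_le _ _)).trans (hC c' hc'))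
    have h5 : ((c'.2.filter (fun v => v ∉ D)).card : ℚ) * B ≤ C * c'.1 := by exact_mod_cast h4
    have ht'' : (0 : ℚ) < c'.1 := by exact_mod_cast ht'
    -- The edges in `D` number at most `ratio (t₀, s₀) * t`, so the long ones must fill the gap up
    -- to `ratio c₁`, against the choice of `B`.
    have h6 : (ratio c₁ - ratio (t₀, s₀)) * c'.1 ≤ (c'.2.filter (fun v => v ∉ D)).card := by
      rw [h3]
      nlinarith
    have h7 := mul_le_mul_of_nonneg_right h6 (Nat.cast_nonneg (α := ℚ) B)
    have h8 := mul_lt_mul_of_pos_right hB ht''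
    linarith
  have hall : ∀ k, ∃ D : Finset (Fin d → ℤ), D.card = k ∧ Cof D := by
    intro k
    induction k with
    | zero => exact ⟨∅, rfl, hstart⟩
    | succ k ih =>
      obtain ⟨D, hDk, hD⟩ := ih
      obtain ⟨v, hv, hvD⟩ := hstep D hD
      exact ⟨insert v D, by rw [Finset.card_insert_of_notMem hv, hDk], hvD⟩
  obtain ⟨D, hDk, hD⟩ := hall (2 * 2 ^ d + 1)
  obtain ⟨c, -, hsub, hle, -⟩ := hD _ (IsConfig.zero hV)
  have := Finset.card_le_card hsub
  omega

/-! ### Passage between polytopes and segments -/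

theorem exists_ne_of_dimension_pos {d : ℕ} {S : Finset (Fin d → ℤ)}
    (h : 0 < dimension (convexHull ℝ (latticeEmb d '' (S : Set (Fin d → ℤ))))) :
    ∃ p ∈ S, ∃ q ∈ S, p ≠ q := by
  by_contra! hS
  have hsub : (convexHull ℝ (latticeEmb d '' (S : Set (Fin d → ℤ)))).Subsingleton := by
    rcases S.eq_empty_or_nonempty with rfl | ⟨p, hp⟩
    · simp
    · have : (S : Set (Fin d → ℤ)) = {p} :=
        Set.eq_singleton_iff_unique_mem.2 ⟨hp, fun q hq => hS q hq p hp⟩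
      simp [this]
  rw [dimension, vectorSpan_of_subsingleton ℝ hsub, finrank_bot] at h
  exact lt_irrefl 0 h

theorem exists_map_eq_of_le_map {α β : Type*} {f : α → β} {s : Multiset α} {r : Multiset β}
    (h : r ≤ s.map f) : ∃ u ≤ s, u.map f = r := by
  classical
  induction s using Multiset.induction_on generalizing r with
  | empty => exact ⟨0, le_rfl, (Multiset.le_zero.1 h).symm⟩
  | cons x s ih =>
    rw [Multiset.map_cons] at h
    by_cases hx : f x ∈ r
    · obtain ⟨r', rfl⟩ := Multiset.exists_cons_of_mem hx
      obtain ⟨u, hu, rfl⟩ := ih ((Multiset.cons_le_cons_iff _).1 h)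
      exact ⟨x ::ₘ u, Multiset.cons_le_cons x hu, Multiset.map_cons f x u⟩
    · obtain ⟨u, hu, rfl⟩ := ih ((Multiset.le_cons_of_notMem hx).1 h)
      exact ⟨u, hu.trans (Multiset.le_cons_self s x), rfl⟩

/-- Two distinct lattice points `p i`, `q i` of each summand give the edge `q i - p i`; every corner
is a sum of chosen endpoints, so it lies in the Minkowski sum. -/
theorem exists_fits_of_mem_counts {d n m : ℕ} {Q : Set (Fin d → ℝ)}
    (h : m ∈ decompositionCountsOfDim n Q) :
    ∃ a s, s.card = m ∧ 0 ∉ s ∧ RankLE n {v | v ∈ s} ∧ Fits Q a s := by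
  classical
  obtain ⟨R, hR, hdim, hsub⟩ := h
  choose S hS using fun i => (hR i).1
  have hS' : ∀ i, R i = convexHull ℝ (latticeEmb d '' (S i : Set (Fin d → ℤ))) := hS
  choose p hp q hq hpq using fun i => exists_ne_of_dimension_pos (hS' i ▸ (hR i).2)
  have hmem : ∀ I : Finset (Fin m),
      latticeEmb d (∑ i, p i + ∑ i ∈ I, (q i - p i)) ∈ ∑ i, R i := by
    intro I
    have : ∑ i, p i + ∑ i ∈ I, (q i - p i) = ∑ i, if i ∈ I then q i else p i := by
      rw [← Finset.sum_ite_mem_eq I, ← Finset.sum_add_distrib]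
      exact Finset.sum_congr rfl fun i _ => by split_ifs <;> simp
    rw [this, map_sum]
    refine Set.finsetSum_mem_finsetSum _ _ _ fun i _ => ?_
    rw [hS' i]
    apply subset_convexHull
    split_ifs
    · exact ⟨q i, hq i, rfl⟩
    · exact ⟨p i, hp i, rfl⟩
  refine ⟨∑ i, p i, (Finset.univ : Finset (Fin m)).val.map fun i => q i - p i, by simp, ?_,
    ⟨vectorSpan ℝ (∑ i, R i), hdim, ?_⟩, ?_⟩
  · intro h0
    obtain ⟨i, -, hi⟩ := Multiset.mem_map.1 h0
    exact hpq i (sub_eq_zero.1 hi).symm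
  · intro v hv
    have hv' : v ∈ (Finset.univ : Finset (Fin m)).val.map fun i => q i - p i := hv
    obtain ⟨i, -, rfl⟩ := Multiset.mem_map.1 hv'
    have := vsub_mem_vectorSpan ℝ (hmem {i}) (hmem ∅)
    simpa using this
  · intro r hr
    obtain ⟨u, hu, rfl⟩ := exists_map_eq_of_le_map hr
    exact hsub (hmem ⟨u, Multiset.nodup_of_le hu Finset.univ.nodup⟩)

theorem mem_counts_of_fits {d n : ℕ} {Q : Set (Fin d → ℝ)} (hQ : Convex ℝ Q) {a : Fin d → ℤ}
    {s : Multiset (Fin d → ℤ)} (hs : 0 < s.card) (h0 : 0 ∉ s) (hn : RankLE n {v | v ∈ s})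
    (h : Fits Q a s) : s.card ∈ decompositionCountsOfDim n Q := by
  classical
  obtain ⟨W, hW, hWs⟩ := hn
  obtain ⟨v, hv⟩ : ∃ v : Fin s.card → Fin d → ℤ,
      (Finset.univ : Finset (Fin s.card)).val.map v = s := by
    have hl : ∀ l : List (Fin d → ℤ),
        (Finset.univ : Finset (Fin (l : Multiset (Fin d → ℤ)).card)).val.map l.get = l := fun l =>
      (Fin.univ_val_map (n := l.length) l.get).trans (congrArg _ (List.ofFn_get l))
    rw [← s.coe_toList]
    exact ⟨s.toList.get, hl _⟩
  have hvs : ∀ i, v i ∈ s := fun i => by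
    rw [← hv]
    exact Multiset.mem_map_of_mem v (Finset.mem_univ i)
  have hvW : ∀ i, latticeEmb d (v i) ∈ W := fun i => hWs _ (hvs i)
  have hv0 : ∀ i, v i ≠ 0 := fun i hi => h0 (hi ▸ hvs i)
  have hfit : ∀ I : Finset (Fin s.card), latticeEmb d (a + ∑ i ∈ I, v i) ∈ Q := by
    intro I
    exact h (I.val.map v)
      ((Multiset.map_le_map (Finset.val_le_iff.2 (Finset.subset_univ I))).trans hv.le)
  -- The base point `a` is absorbed into one segment, which requires at least one summand.
  let i₀ : Fin s.card := ⟨0, hs⟩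
  let b : Fin s.card → Fin d → ℤ := Pi.single i₀ a
  have hb : ∑ i, b i = a := Finset.sum_pi_single' _ _ _ |>.trans (by simp)
  let S : Fin s.card → Finset (Fin d → ℤ) := fun i => {b i, b i + v i}
  let R : Fin s.card → Set (Fin d → ℝ) := fun i =>
    convexHull ℝ (latticeEmb d '' (S i : Set (Fin d → ℤ)))
  have hmin : ∀ C : Set (Fin d → ℝ), Convex ℝ C →
      (∀ I : Finset (Fin s.card), latticeEmb d (a + ∑ i ∈ I, v i) ∈ C) → ∑ i, R i ⊆ C := by
    intro C hC hI
    show ∑ i, convexHull ℝ (latticeEmb d '' (S i : Set (Fin d → ℤ))) ⊆ C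
    rw [← convexHull_sum]
    refine convexHull_min ?_ hC
    intro x hx
    obtain ⟨y, hy, rfl⟩ := (Set.mem_fintype_sum _ _).1 hx
    choose z hz hzy using hy
    have hz' : ∀ i, z i = b i + if z i = b i then 0 else v i := by
      intro i
      have := hz i
      simp only [S, Finset.coe_insert, Finset.coe_singleton, Set.mem_insert_iff,
        Set.mem_singleton_iff] at this
      split_ifs with hi
      · rw [hi, add_zero]
      · exact this.resolve_left hi
    have hsum : ∑ i, y i = latticeEmb d (a + ∑ i with ¬ z i = b i, v i) := by
      rw [Finset.sum_filter, ← hb, ← Finset.sum_add_distrib, map_sum]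
      refine Finset.sum_congr rfl fun i _ => ?_
      rw [← hzy i]
      congr 1
      conv_lhs => rw [hz' i]
      by_cases hi : z i = b i <;> simp [hi]
    rw [hsum]
    exact hI _
  refine ⟨R, fun i => ⟨⟨S i, rfl⟩, ?_⟩, ?_, hmin Q hQ hfit⟩
  · have hmem : latticeEmb d (v i) ∈ vectorSpan ℝ (R i) := by
      have h1 : latticeEmb d (b i + v i) ∈ R i :=
        subset_convexHull ℝ _ ⟨b i + v i, by simp [S], rfl⟩
      have h2 : latticeEmb d (b i) ∈ R i := subset_convexHull ℝ _ ⟨b i, by simp [S], rfl⟩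
      simpa using vsub_mem_vectorSpan ℝ h1 h2
    refine Submodule.one_le_finrank_iff.2 fun hbot => hv0 i ?_
    rw [hbot, Submodule.mem_bot] at hmem
    exact latticeEmb_injective d (by rw [hmem, map_zero])
  -- The same convex-hull argument, applied to the coset `a + W`, bounds the dimension.
  · have hcoset : ∑ i, R i ⊆ {x | x - latticeEmb d a ∈ W} := by
      refine hmin _ ?_ fun I => ?_
      · intro x hx y hy α β _ _ hαβ
        have hx' : x - latticeEmb d a ∈ W := hx
        have hy' : y - latticeEmb d a ∈ W := hy
        have := W.add_mem (W.smul_mem α hx') (W.smul_mem β hy')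
        show α • x + β • y - latticeEmb d a ∈ W
        convert this using 1
        rw [smul_sub, smul_sub]
        nth_rewrite 1 [← one_smul ℝ (latticeEmb d a), ← hαβ, add_smul]
        abel
      · show latticeEmb d (a + ∑ i ∈ I, v i) - latticeEmb d a ∈ W
        rw [map_add, add_sub_cancel_left, map_sum]
        exact W.sum_mem fun i _ => hvW i
    refine (Submodule.finrank_mono (Submodule.span_le.2 ?_)).trans hW
    intro x hx
    obtain ⟨y, hy, z, hz, rfl⟩ := hx
    have hy' : y - latticeEmb d a ∈ W := hcoset hy
    have hz' : z - latticeEmb d a ∈ W := hcoset hz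
    simpa using W.sub_mem hy' hz'

/-! ### Attainment for the Minkowski lengths -/

theorem decompositionCounts_eq {d : ℕ} (Q : Set (Fin d → ℝ)) :
    decompositionCounts Q = decompositionCountsOfDim d Q := by
  have hd : ∀ R : Set (Fin d → ℝ), dimension R ≤ d := fun R =>
    (Submodule.finrank_le _).trans (by simp)
  ext m
  constructor
  · rintro ⟨R, h1, h2⟩
    exact ⟨R, h1, hd _, h2⟩
  · rintro ⟨R, h1, -, h2⟩
    exact ⟨R, h1, h2⟩

theorem minkowskiLength_eq {d : ℕ} (Q : Set (Fin d → ℝ)) :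
    minkowskiLength Q = nthMinkowskiLength d Q := by
  rw [minkowskiLength, decompositionCounts_eq, nthMinkowskiLength]

theorem rationalMinkowskiLength_eq {d : ℕ} (Q : Set (Fin d → ℝ)) :
    rationalMinkowskiLength Q = nthRationalMinkowskiLength d Q := by
  simp only [rationalMinkowskiLength, minkowskiLength_eq, nthRationalMinkowskiLength]

theorem isConfig_of_mem_counts {d n m : ℕ} {P : Set (Fin d → ℝ)} (t : ℕ+)
    (h : m ∈ decompositionCountsOfDim n ((t : ℝ) • P)) :
    ∃ s, s.card = m ∧ IsConfig n P (t, s) := by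
  obtain ⟨a, s, h1, h2, h3, h4⟩ := exists_fits_of_mem_counts h
  exact ⟨s, h1, t.pos, h2, h3, a, h4⟩

theorem bddAbove_counts {d n : ℕ} {P : Set (Fin d → ℝ)} (hP : IsLatticePolytope P) (t : ℕ+) :
    BddAbove (decompositionCountsOfDim n ((t : ℝ) • P)) := by
  obtain ⟨V, hV⟩ := hP
  obtain ⟨C, hC⟩ := exists_length_bound (n := n) V
  refine ⟨C * t, fun m hm => ?_⟩
  obtain ⟨s, rfl, hs⟩ := isConfig_of_mem_counts t hm
  have h1 := card_mul_le_sum_normOne (B := 1) s fun v hv =>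
    normOne_pos fun h0 => hs.2.1 (h0 ▸ hv)
  rw [mul_one] at h1
  exact h1.trans (hC (t, s) (hV ▸ hs))

/-- A nonzero value rules out the default `sSup ∅ = 0`. The set of counts can be empty, since the
empty sum `{0}` is admissible only when the origin lies in `tP`. -/
theorem nthMinkowskiLength_mem {d n : ℕ} {P : Set (Fin d → ℝ)} (hP : IsLatticePolytope P)
    (t : ℕ+) (h : nthMinkowskiLength n ((t : ℝ) • P) ≠ 0) :
    nthMinkowskiLength n ((t : ℝ) • P) ∈ decompositionCountsOfDim n ((t : ℝ) • P) := by
  refine Nat.sSup_mem (Set.nonempty_iff_ne_empty.2 fun h0 => h ?_) (bddAbove_counts hP t)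
  rw [nthMinkowskiLength, h0]
  simp

/-- The ratios `L_n(tP) / t` have a maximum. -/
theorem exists_max_nthMinkowskiLength {d : ℕ} (n : ℕ) {P : Set (Fin d → ℝ)}
    (hP : IsLatticePolytope P) :
    ∃ k : ℕ+, ∀ t : ℕ+, (nthMinkowskiLength n ((t : ℝ) • P) : ℝ) / (t : ℝ) ≤
      (nthMinkowskiLength n ((k : ℝ) • P) : ℝ) / (k : ℝ) := by
  by_cases hne : P.Nonempty
  · obtain ⟨V, hV⟩ := id hP
    have hV' : P = convexHull ℝ (latticeEmb d '' (V : Set (Fin d → ℤ))) := hV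
    have hVne : V.Nonempty := by
      rw [hV'] at hne
      simpa using hne
    obtain ⟨⟨k, s⟩, hc, hmax⟩ := exists_max_config (n := n) hVne
    rw [← hV'] at hc hmax
    have hconv : Convex ℝ P := hV' ▸ convex_convexHull ℝ _
    have hs : s.card ≤ nthMinkowskiLength n ((k : ℝ) • P) := by
      rcases Nat.eq_zero_or_pos s.card with h | h
      · omega
      · obtain ⟨-, h1, h2, a, h3⟩ := id hc
        exact le_csSup (bddAbove_counts hP ⟨k, hc.1⟩)
          (mem_counts_of_fits (hconv.smul _) h h1 h2 h3)
    refine ⟨⟨k, hc.1⟩, fun t => ?_⟩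
    have hk : (0 : ℝ) < k := by exact_mod_cast hc.1
    have ht : (0 : ℝ) < (t : ℕ) := by exact_mod_cast t.pos
    show _ ≤ (nthMinkowskiLength n ((k : ℝ) • P) : ℝ) / (k : ℝ)
    by_cases h0 : nthMinkowskiLength n ((t : ℝ) • P) = 0
    · rw [h0]
      simp only [Nat.cast_zero, zero_div]
      positivity
    · obtain ⟨r, hr, hrc⟩ := isConfig_of_mem_counts t (nthMinkowskiLength_mem hP t h0)
      have h1 : (((r.card : ℚ) / (t : ℕ) : ℚ) : ℝ) ≤ (((s.card : ℚ) / k : ℚ) : ℝ) :=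
        Rat.cast_le.2 (hmax _ hrc)
      push_cast at h1
      rw [← hr]
      refine h1.trans ?_
      gcongr
  -- For empty `P` all lengths vanish, and any dilation factor attains the maximum.
  · refine ⟨1, fun t => ?_⟩
    have : nthMinkowskiLength n ((t : ℝ) • P) = 0 := by
      by_contra h0
      obtain ⟨r, -, -, -, -, a, h⟩ := isConfig_of_mem_counts t (nthMinkowskiLength_mem hP t h0)
      obtain ⟨y, hy, -⟩ := h 0 (Multiset.zero_le _)
      exact hne ⟨y, hy⟩
    rw [this]
    simp only [Nat.cast_zero, zero_div]
    positivity

theorem nthRationalMinkowskiLength_attained {d : ℕ} (n : ℕ) {P : Set (Fin d → ℝ)}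
    (hP : IsLatticePolytope P) :
    (∀ t : ℕ+, BddAbove (decompositionCountsOfDim n ((t : ℝ) • P))) ∧
      BddAbove (Set.range fun t : ℕ+ =>
        (nthMinkowskiLength n ((t : ℝ) • P) : ℝ) / (t : ℝ)) ∧
      (∃ k : ℕ+, nthRationalMinkowskiLength n P =
        (nthMinkowskiLength n ((k : ℝ) • P) : ℝ) / (k : ℝ)) ∧
      (∃ q : ℚ, nthRationalMinkowskiLength n P = (q : ℝ)) := by
  obtain ⟨k, hk⟩ := exists_max_nthMinkowskiLength n hP
  have hbdd : BddAbove (Set.range fun t : ℕ+ =>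
      (nthMinkowskiLength n ((t : ℝ) • P) : ℝ) / (t : ℝ)) :=
    ⟨_, Set.forall_mem_range.2 hk⟩
  have heq : nthRationalMinkowskiLength n P =
      (nthMinkowskiLength n ((k : ℝ) • P) : ℝ) / (k : ℝ) :=
    le_antisymm (ciSup_le hk) (le_ciSup hbdd k)
  refine ⟨bddAbove_counts hP, hbdd, ⟨k, heq⟩,
    (nthMinkowskiLength n ((k : ℝ) • P) : ℚ) / ((k : ℕ) : ℚ), ?_⟩
  rw [heq]
  push_cast
  rfl

end MinkowskiLength

theorem theoremT (d : ℕ) (P : Set (Fin d → ℝ)) (hP : MinkowskiLength.IsLatticePolytope P) :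
    -- the numbers `L(tP)` and `λ(P)` are suprema of sets that are bounded above
    ((∀ t : ℕ+, BddAbove (MinkowskiLength.decompositionCounts ((t : ℝ) • P))) ∧
      BddAbove (Set.range fun t : ℕ+ =>
        (MinkowskiLength.minkowskiLength ((t : ℝ) • P) : ℝ) / (t : ℝ)) ∧
      -- `λ(P)` is attained, and rational
      (∃ k : ℕ+, MinkowskiLength.rationalMinkowskiLength P =
        (MinkowskiLength.minkowskiLength ((k : ℝ) • P) : ℝ) / (k : ℝ)) ∧
      (∃ q : ℚ, MinkowskiLength.rationalMinkowskiLength P = (q : ℝ))) ∧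
    -- the same for `L_n(tP)` and `λ_n(P)`
    (∀ n : ℕ, 1 ≤ n → n ≤ d →
      (∀ t : ℕ+, BddAbove (MinkowskiLength.decompositionCountsOfDim n ((t : ℝ) • P))) ∧
      BddAbove (Set.range fun t : ℕ+ =>
        (MinkowskiLength.nthMinkowskiLength n ((t : ℝ) • P) : ℝ) / (t : ℝ)) ∧
      (∃ k : ℕ+, MinkowskiLength.nthRationalMinkowskiLength n P =
        (MinkowskiLength.nthMinkowskiLength n ((k : ℝ) • P) : ℝ) / (k : ℝ)) ∧
      (∃ q : ℚ, MinkowskiLength.nthRationalMinkowskiLength n P = (q : ℝ))) := by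
  refine ⟨?_, fun n _ _ => MinkowskiLength.nthRationalMinkowskiLength_attained n hP⟩
  simp only [MinkowskiLength.decompositionCounts_eq, MinkowskiLength.minkowskiLength_eq,
    MinkowskiLength.rationalMinkowskiLength_eq]
  exact MinkowskiLength.nthRationalMinkowskiLength_attained d hP
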